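/- Let $\beta\ge 1$, let $b_j\in\{1,-1\}$ $(j\ge 1)$ be a sequence with $b_{j+\beta}=b_j$ for all $j$, and let $A_1,\dots,A_\beta\in\mathbb{Z}[x]$ be polynomials with $A_i(n)>0$ for all integers $n\ge 1$ and all $i$. Put $a_{(n-1)\beta+i}=A_i(n)$ for $n\ge 1$ and $1\le i\le\beta$, and let $a_0\in\mathbb{Z}$. Suppose that the (signed interlaced) continued fraction $$a_0+\cfrac{b_1}{a_1+\cfrac{b_2}{a_2+\cfrac{b_3}{a_3+\cdots}}}$$ converges to an irrational number $\alpha$, that is, its convergents are finite from some index on and tend to $\alpha$. Then there are integers $p,q,r,s$ with $ps-qr\neq 0$, an integer $\beta'\ge 1$ and polynomials $A'_1,\dots,A'_{\beta'}\in\mathbb{Z}[x]$ with $A'_i(n)>0$ for all $n\ge 1$ and all $i$ such that, with $a'_{(n-1)\beta'+i}=A'_i(n)$ for $n\ge 1$ and $1\le i\le\beta'$, the simple interlaced continued fraction $$\cfrac{1}{a'_1+\cfrac{1}{a'_2+\cfrac{1}{a'_3+\cdots}}}$$ converges to $\dfrac{p\alpha+q}{r\alpha+s}$. -/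

import Mathlib

open Filter Topology Polynomial

/-- The infinite continued fraction `a₀ + b 0 / (a 0 + b 1 / (a 1 + b 2 / (a 2 + ⋯)))`
with integer leading term `a₀`, partial numerators `b` and partial denominators `a`.
(The sequences are indexed from `0`, so `b j`, `a j` belong to the layer number `j + 1`.) -/
noncomputable def intCF (a₀ : ℤ) (b a : ℕ → ℤ) : GenContFract ℝ where
  h := (a₀ : ℝ)
  s := Stream'.Seq.ofStream fun j => ⟨(b j : ℝ), (a j : ℝ)⟩

/-- The continued fraction `g` converges to the real number `x`: its convergents `pₙ / qₙ`
are defined (that is, `qₙ ≠ 0`) for all large `n` and they tend to `x`. -/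
def CFConvergesTo (g : GenContFract ℝ) (x : ℝ) : Prop :=
  (∀ᶠ n in atTop, g.dens n ≠ 0) ∧ Tendsto g.convs atTop (𝓝 x)

/-- The sequence `a` interlaces `β` integer polynomials `A 0, …, A (β - 1)`: its `n`-th block of
length `β`, `n = 1, 2, …`, is `(A 0) n, …, (A (β - 1)) n`. -/
def IsInterlacedPolynomial (β : ℕ) (a : ℕ → ℤ) : Prop :=
  ∃ A : Fin β → ℤ[X], ∀ (n : ℕ) (i : Fin β), a (n * β + i) = (A i).eval ((n : ℤ) + 1)

/-- `b`, `a` are the partial numerators and the partial denominators of a signed interlaced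
continued fraction of period `β ≥ 1`. -/
structure IsSignedInterlacedCF (β : ℕ) (b a : ℕ → ℤ) : Prop where
  period_pos : 0 < β
  num_sign : ∀ j, b j = 1 ∨ b j = -1
  num_periodic : Function.Periodic b β
  den_pos : ∀ j, 0 < a j
  den_interlaced : IsInterlacedPolynomial β a

/-- `a` is the sequence of partial denominators of a simple interlaced continued fraction
(all of whose partial numerators are `1`) of period `β ≥ 1`. -/
structure IsSimpleInterlacedCF (β : ℕ) (a : ℕ → ℤ) : Prop where
  period_pos : 0 < β
  den_pos : ∀ j, 0 < a j
  den_interlaced : IsInterlacedPolynomial β a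

/-! Convergents are images of `∞` under products in GL₂(ℤ) of maps `x ↦ P(n) + b/x`. Enlarge the
class: consider periodic products of letters `x ↦ P(n) + G x` with `G` any element of GL₂(ℤ).
Rotating the period cyclically changes the limit by a homography, and adjacent letters may be merged
whenever the result is again a letter. A letter with constant `P` merges into its predecessor; one
with `G ∞ = ∞` is affine and merges with its successor. This shortens the period
(`equivSimple_of_letters`) until one of two cases is left.

A single constant letter `C`: the limit of `C ^ n ∞` is a fixed point of `C`, hence a quadratic
irrational, homographic to some `[0; m, 1, m, 1, …]` (`equivSimple_of_pow`).

All letters with `|P(n)| → ∞` and `G ∞ ≠ ∞` (`equivSimple_of_proper`): sign changes make every `P(n)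
→ +∞`, and Euclid's algorithm writes `±G` as a positive continued fraction between two translations.
These translations are absorbed by the neighbouring polynomials, which stay positive for large `n`.
What is left at the end of a block is removed by conjugation, and finitely many blocks are dropped.
The resulting simple continued fraction converges by positivity; its limit is identified along the
ends of blocks. -/

namespace InterlacedCF

/-! ### Integral projective transformations and their ordered products -/

/-- Integral projective transformations of the line. -/
abbrev GL2Z := Matrix.GeneralLinearGroup (Fin 2) ℤ

/-- The translation `x ↦ x + z`. -/
def trans (z : ℤ) : GL2Z where
  val := !![1, z; 0, 1]
  inv := !![1, -z; 0, 1]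
  val_inv := by ext i j; fin_cases i <;> fin_cases j <;> simp [Matrix.mul_apply]
  inv_val := by ext i j; fin_cases i <;> fin_cases j <;> simp [Matrix.mul_apply]

/-- The map `x ↦ b / x` for a sign `b`. -/
def signedInv (b : ℤˣ) : GL2Z where
  val := !![0, b; 1, 0]
  inv := !![0, 1; b, 0]
  val_inv := by
    ext i j; fin_cases i <;> fin_cases j <;> simp [Matrix.mul_apply]
  inv_val := by
    ext i j; fin_cases i <;> fin_cases j <;> simp [Matrix.mul_apply]

/-- The map `x ↦ -x`. -/
def negation : GL2Z where
  val := !![-1, 0; 0, 1]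
  inv := !![-1, 0; 0, 1]
  val_inv := by ext i j; fin_cases i <;> fin_cases j <;> simp [Matrix.mul_apply]
  inv_val := by ext i j; fin_cases i <;> fin_cases j <;> simp [Matrix.mul_apply]

@[simp] lemma trans_val (z : ℤ) : (trans z).val = !![1, z; 0, 1] := rfl
@[simp] lemma signedInv_val (b : ℤˣ) : (signedInv b).val = !![0, (b : ℤ); 1, 0] := rfl
@[simp] lemma negation_val : negation.val = !![-1, 0; 0, 1] := rfl

lemma mul_entry (X Y : GL2Z) (i j : Fin 2) :
    (X * Y).val i j = X.val i 0 * Y.val 0 j + X.val i 1 * Y.val 1 j := by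
  simp [Matrix.mul_apply]

lemma gl_ext {X Y : GL2Z} (h00 : X.val 0 0 = Y.val 0 0) (h01 : X.val 0 1 = Y.val 0 1)
    (h10 : X.val 1 0 = Y.val 1 0) (h11 : X.val 1 1 = Y.val 1 1) : X = Y := by
  apply Units.ext
  ext i j
  fin_cases i <;> fin_cases j <;> assumption

lemma det_entries (X : GL2Z) :
    X.val 0 0 * X.val 1 1 - X.val 0 1 * X.val 1 0 = 1 ∨
      X.val 0 0 * X.val 1 1 - X.val 0 1 * X.val 1 0 = -1 := by
  rw [← Matrix.det_fin_two]
  exact Int.isUnit_iff.1 ((Matrix.isUnit_iff_isUnit_det _).1 X.isUnit)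

lemma trans_add (x y : ℤ) : trans (x + y) = trans x * trans y := by
  apply gl_ext <;> simp [mul_entry, add_comm]

lemma trans_zero : trans 0 = 1 := by
  apply gl_ext <;> simp

lemma negation_mul_trans (z : ℤ) : negation * trans z = trans (-z) * negation := by
  apply gl_ext <;> simp [mul_entry]

lemma negation_mul_self : negation * negation = 1 := by
  apply gl_ext <;> simp [mul_entry]

/-- The ordered product `f 0 * ⋯ * f (n - 1)`. -/
def prodTo (f : ℕ → GL2Z) : ℕ → GL2Z
  | 0 => 1
  | n + 1 => prodTo f n * f n

lemma prodTo_succ' (f : ℕ → GL2Z) (n : ℕ) :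
    prodTo f (n + 1) = f 0 * prodTo (fun k => f (k + 1)) n := by
  induction n with
  | zero => simp [prodTo]
  | succ n ih => rw [prodTo, ih, mul_assoc]; rfl

lemma prodTo_add (f : ℕ → GL2Z) (m n : ℕ) :
    prodTo f (m + n) = prodTo f m * prodTo (fun k => f (m + k)) n := by
  induction n with
  | zero => simp [prodTo]
  | succ n ih => rw [← add_assoc, prodTo, ih, mul_assoc]; rfl

lemma prodTo_const (C : GL2Z) (n : ℕ) : prodTo (fun _ => C) n = C ^ n := by
  induction n with
  | zero => rfl
  | succ n ih => rw [prodTo, ih, pow_succ]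

/-! ### Limits of images of infinity, and homographies -/

/-- The images of `∞` under the transformations `f n` tend to the real number `α`. -/
def ImageInftyTendsto (f : ℕ → GL2Z) (α : ℝ) : Prop :=
  (∀ᶠ n in atTop, (f n).val 1 0 ≠ 0) ∧
    Tendsto (fun n => ((f n).val 0 0 : ℝ) / ((f n).val 1 0 : ℝ)) atTop (𝓝 α)

/-- The action of an integral projective transformation on the real line. -/
noncomputable def mobius (X : GL2Z) (α : ℝ) : ℝ :=
  (X.val 0 0 * α + X.val 0 1) / (X.val 1 0 * α + X.val 1 1)

lemma irrational_linear_ne_zero {α : ℝ} (h : Irrational α) {c d : ℤ} (hcd : c ≠ 0 ∨ d ≠ 0) :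
    (c : ℝ) * α + d ≠ 0 := by
  intro h0
  by_cases hc : c = 0
  · subst hc
    simp at h0 hcd
    exact hcd h0
  · refine h ⟨-d / c, ?_⟩
    have : (c : ℝ) ≠ 0 := by exact_mod_cast hc
    push_cast
    field_simp
    linarith

lemma mobius_den_ne_zero (X : GL2Z) {α : ℝ} (h : Irrational α) :
    (X.val 1 0 : ℝ) * α + X.val 1 1 ≠ 0 := by
  apply irrational_linear_ne_zero h
  by_contra! hc
  have := det_entries X
  simp [hc.1, hc.2] at this

lemma irrational_mobius_of_det {p q r s : ℤ} {α : ℝ} (h : Irrational α)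
    (hdet : p * s - q * r ≠ 0) : Irrational ((p * α + q) / (r * α + s)) := by
  rintro ⟨t, ht⟩
  have hrs : (r : ℝ) * α + s ≠ 0 := by
    apply irrational_linear_ne_zero h
    by_contra! hc
    simp [hc.1, hc.2] at hdet
  rw [eq_div_iff hrs, Rat.cast_def] at ht
  have hd : (t.den : ℝ) ≠ 0 := by exact_mod_cast t.den_ne_zero
  field_simp at ht
  have h2 : ((t.num * r - t.den * p : ℤ) : ℝ) * α + ((t.num * s - t.den * q : ℤ) : ℝ) = 0 := by
    push_cast; linarith
  refine irrational_linear_ne_zero h ?_ h2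
  by_contra! hc
  have hd' : (t.den : ℤ) ≠ 0 := by exact_mod_cast t.den_ne_zero
  have : (t.den : ℤ) * (p * s - q * r) = 0 := by
    linear_combination (-s) * hc.1 + r * hc.2
  simp_all

lemma irrational_mobius (X : GL2Z) {α : ℝ} (h : Irrational α) : Irrational (mobius X α) := by
  apply irrational_mobius_of_det h
  rcases det_entries X with h | h <;> rw [h] <;> decide

lemma ImageInftyTendsto.congr {f g : ℕ → GL2Z} {α : ℝ} (h : ImageInftyTendsto f α)
    (hfg : ∀ n, (g n).val 0 0 = (f n).val 0 0 ∧ (g n).val 1 0 = (f n).val 1 0) :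
    ImageInftyTendsto g α := by
  simpa only [ImageInftyTendsto, hfg] using h

/-- Matrices stand for projective maps, so an overall sign is immaterial. -/
lemma ImageInftyTendsto.congr_neg {f g : ℕ → GL2Z} {α : ℝ} (h : ImageInftyTendsto f α)
    (hfg : ∀ n, g n = f n ∨ g n = -f n) : ImageInftyTendsto g α := by
  refine ⟨?_, ?_⟩
  · filter_upwards [h.1] with n hn
    rcases hfg n with h | h <;> simp [h, hn]
  · refine h.2.congr fun n => ?_
    rcases hfg n with h | h <;> simp [h]

/-- Irrationality keeps `α` away from the pole of `X`, so `X` is continuous at `α`. -/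
lemma ImageInftyTendsto.mul_left {f : ℕ → GL2Z} {α : ℝ} (h : ImageInftyTendsto f α)
    (hα : Irrational α) (X : GL2Z) :
    ImageInftyTendsto (fun n => X * f n) (mobius X α) := by
  have hden : Tendsto (fun n => (X.val 1 0 : ℝ) * (((f n).val 0 0 : ℝ) / ((f n).val 1 0 : ℝ))
      + X.val 1 1) atTop (𝓝 (X.val 1 0 * α + X.val 1 1)) := (h.2.const_mul _).add_const _
  have hnum : Tendsto (fun n => (X.val 0 0 : ℝ) * (((f n).val 0 0 : ℝ) / ((f n).val 1 0 : ℝ))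
      + X.val 0 1) atTop (𝓝 (X.val 0 0 * α + X.val 0 1)) := (h.2.const_mul _).add_const _
  have hne := hden.eventually_ne (mobius_den_ne_zero X hα)
  refine ⟨?_, ?_⟩
  · filter_upwards [h.1, hne] with n h1 h2 h3
    apply h2
    have h1' : ((f n).val 1 0 : ℝ) ≠ 0 := by exact_mod_cast h1
    rw [mul_entry] at h3
    have h4 : (X.val 1 0 : ℝ) * (f n).val 0 0 + X.val 1 1 * (f n).val 1 0 = 0 := by
      exact_mod_cast h3
    rw [mul_div_assoc', div_add' _ _ _ h1', h4, zero_div]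
  · refine (hnum.div hden (mobius_den_ne_zero X hα)).congr' ?_
    filter_upwards [h.1, hne] with n h1 h2
    have h1' : ((f n).val 1 0 : ℝ) ≠ 0 := by exact_mod_cast h1
    simp only [Pi.div_apply]
    rw [mul_entry, mul_entry, ← mul_div_mul_right _ _ h1']
    push_cast
    congr 1 <;> field_simp

lemma ImageInftyTendsto.comp {f : ℕ → GL2Z} {α : ℝ} (h : ImageInftyTendsto f α) {φ : ℕ → ℕ}
    (hφ : Tendsto φ atTop atTop) : ImageInftyTendsto (fun n => f (φ n)) α :=
  ⟨hφ.eventually h.1, h.2.comp hφ⟩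

lemma homography_div (p q r s N : ℝ) {D : ℝ} (hD : D ≠ 0) :
    (p * (N / D) + q) / (r * (N / D) + s) = (p * N + q * D) / (r * N + s * D) := by
  rw [← mul_div_mul_right _ _ hD, add_mul, add_mul, mul_assoc, mul_assoc, div_mul_cancel₀ _ hD]

/-- The number `α` is, up to an integral homography, the value of a simple interlaced
continued fraction. -/
def EquivSimple (α : ℝ) : Prop :=
  ∃ p q r s : ℤ, p * s - q * r ≠ 0 ∧ (r : ℝ) * α + s ≠ 0 ∧
    ∃ (β' : ℕ) (a' : ℕ → ℤ), IsSimpleInterlacedCF β' a' ∧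
      CFConvergesTo (intCF 0 (fun _ => 1) a') (((p : ℝ) * α + q) / ((r : ℝ) * α + s))

lemma EquivSimple.of_homography {α : ℝ} (hα : Irrational α) {p q r s : ℤ}
    (hdet : p * s - q * r ≠ 0) (h : EquivSimple ((p * α + q) / (r * α + s))) :
    EquivSimple α := by
  obtain ⟨p', q', r', s', hdet', hne, β', a', h1, h2⟩ := h
  have hrs : (r : ℝ) * α + s ≠ 0 := by
    apply irrational_linear_ne_zero hα
    by_contra! hc
    simp [hc.1, hc.2] at hdet
  have hd : (p' * p + q' * r) * (r' * q + s' * s) - (p' * q + q' * s) * (r' * p + s' * r) ≠ 0 := by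
    have : (p' * p + q' * r) * (r' * q + s' * s) - (p' * q + q' * s) * (r' * p + s' * r) =
      (p' * s' - q' * r') * (p * s - q * r) := by ring
    rw [this]
    exact mul_ne_zero hdet' hdet
  have hne2 : ((r' * p + s' * r : ℤ) : ℝ) * α + (r' * q + s' * s : ℤ) ≠ 0 := by
    intro h0
    apply hne
    rw [mul_div_assoc', div_add' _ _ _ hrs, div_eq_zero_iff]
    left
    rw [← h0]
    push_cast
    ring
  refine ⟨p' * p + q' * r, p' * q + q' * s, r' * p + s' * r, r' * q + s' * s, hd, hne2,
    β', a', h1, ?_⟩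
  convert h2 using 1
  rw [homography_div _ _ _ _ _ hrs]
  push_cast
  congr 1 <;> ring

lemma EquivSimple.of_mobius {α : ℝ} (hα : Irrational α) (X : GL2Z)
    (h : EquivSimple (mobius X α)) : EquivSimple α := by
  refine EquivSimple.of_homography hα ?_ h
  rcases det_entries X with h | h <;> rw [h] <;> decide

/-! ### Convergents, and convergence for positive partial denominators -/

/-- The convergents of a signed continued fraction as images of `∞`. -/
lemma nums_dens_intCF (a₀ : ℤ) (b : ℕ → ℤˣ) (a : ℕ → ℤ) (n : ℕ) :
    let M := trans a₀ * signedInv (b 0) * prodTo (fun j => trans (a j) * signedInv (b (j + 1))) n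
    (intCF a₀ (fun j => b j) a).nums n = M.val 0 0 ∧
      (intCF a₀ (fun j => b j) a).dens n = M.val 1 0 := by
  set g := intCF a₀ (fun j => (b j : ℤ)) a with hg
  set f := fun j => trans (a j) * signedInv (b (j + 1)) with hf
  set M := fun n => trans a₀ * signedInv (b 0) * prodTo f n with hM
  have hs : ∀ n, g.s.get? n = some ⟨((b n : ℤ) : ℝ), (a n : ℝ)⟩ := fun n => rfl
  have hsucc : ∀ n, M (n + 1) = M n * f n := fun n => by simp [hM, prodTo, mul_assoc]
  have hcol : ∀ n i, (M (n + 1)).val i 0 = a n * (M n).val i 0 + (M n).val i 1 ∧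
      (M (n + 1)).val i 1 = b (n + 1) * (M n).val i 0 := by
    intro n i
    rw [hsucc]
    simp [hf, mul_entry]
    constructor <;> ring
  have hM0 : (M 0).val = !![a₀, (b 0 : ℤ); 1, 0] := by
    ext i j
    fin_cases i <;> fin_cases j <;> simp [hM, prodTo, Matrix.mul_apply]
  suffices h : ∀ n, (g.nums n = (M n).val 0 0 ∧ g.dens n = (M n).val 1 0) ∧
      (g.nums (n + 1) = (M (n + 1)).val 0 0 ∧ g.dens (n + 1) = (M (n + 1)).val 1 0) from (h n).1
  intro n
  induction n with
  | zero =>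
    refine ⟨⟨?_, ?_⟩, ?_, ?_⟩
    · rw [hM0]; simp [hg, intCF]
    · rw [hM0]; simp
    · rw [(hcol 0 0).1, GenContFract.first_num_eq (hs 0), hM0]; simp [hg, intCF]
    · rw [(hcol 0 1).1, GenContFract.first_den_eq (hs 0), hM0]; simp
  | succ n ih =>
    refine ⟨ih.2, ?_, ?_⟩
    · rw [GenContFract.nums_recurrence (hs (n + 1)) ih.1.1 ih.2.1, (hcol (n + 1) 0).1,
        (hcol n 0).2]
      push_cast; ring
    · rw [GenContFract.dens_recurrence (hs (n + 1)) ih.1.2 ih.2.2, (hcol (n + 1) 1).1,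
        (hcol n 1).2]
      push_cast; ring

lemma cfConvergesTo_intCF_iff (a₀ : ℤ) (b : ℕ → ℤˣ) (a : ℕ → ℤ) (α : ℝ) :
    CFConvergesTo (intCF a₀ (fun j => b j) a) α ↔ ImageInftyTendsto (fun n =>
      trans a₀ * signedInv (b 0) * prodTo (fun j => trans (a j) * signedInv (b (j + 1))) n) α := by
  have h := nums_dens_intCF a₀ b a
  simp only at h
  have hc : (intCF a₀ (fun j => (b j : ℤ)) a).convs = fun n =>
      (intCF a₀ (fun j => (b j : ℤ)) a).nums n / (intCF a₀ (fun j => (b j : ℤ)) a).dens n := rfl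
  rw [CFConvergesTo, ImageInftyTendsto, hc]
  simp only [h, ne_eq, Int.cast_eq_zero]

/-- Determinant `±1` makes consecutive convergents differ by the reciprocal of the product of their
denominators. That product at least doubles at each step, so the convergents form a Cauchy sequence.
-/
lemma exists_limit_of_pos {a : ℕ → ℤ} (ha : ∀ j, 0 < a j) :
    ∃ γ : ℝ, 0 ≤ γ ∧ ImageInftyTendsto (fun n =>
      signedInv 1 * prodTo (fun j => trans (a j) * signedInv 1) n) γ := by
  set M := fun n => signedInv 1 * prodTo (fun j => trans (a j) * signedInv 1) n with hM
  have hcol : ∀ n i, (M (n + 1)).val i 0 = a n * (M n).val i 0 + (M n).val i 1 ∧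
      (M (n + 1)).val i 1 = (M n).val i 0 := by
    intro n i
    have : M (n + 1) = M n * (trans (a n) * signedInv 1) := by simp [hM, prodTo, mul_assoc]
    rw [this]
    simp [mul_entry]
    ring
  have hM0 : (M 0).val = !![0, 1; 1, 0] := by simp [hM, prodTo]
  have hpos : ∀ n, 0 ≤ (M n).val 0 0 ∧ 0 ≤ (M n).val 0 1 ∧ 0 < (M n).val 1 0 ∧
      0 ≤ (M n).val 1 1 ∧ (M n).val 1 1 ≤ (M n).val 1 0 := by
    intro n
    induction n with
    | zero => simp [hM0]
    | succ n ih =>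
      obtain ⟨h1, h2, h3, h4, h5⟩ := ih
      rw [(hcol n 0).1, (hcol n 0).2, (hcol n 1).1, (hcol n 1).2]
      have := ha n
      refine ⟨by positivity, h1, by positivity, h3.le, by nlinarith⟩
  have hgrow : ∀ n, (2 : ℤ) ^ n ≤ (M n).val 1 0 * (M (n + 1)).val 1 0 := by
    intro n
    induction n with
    | zero =>
      have : 1 ≤ a 0 := ha 0
      rw [(hcol 0 1).1, hM0]
      simp only [Matrix.of_apply, Matrix.cons_val]
      linarith
    | succ n ih =>
      obtain ⟨-, -, h3, -, -⟩ := hpos n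
      obtain ⟨-, -, h3', -, h5'⟩ := hpos (n + 1)
      rw [(hcol n 1).2] at h5'
      rw [(hcol (n + 1) 1).1, (hcol n 1).2, pow_succ]
      have : 1 ≤ a (n + 1) := ha (n + 1)
      nlinarith [mul_le_mul_of_nonneg_left h5' h3'.le,
        mul_le_mul_of_nonneg_left this (mul_nonneg h3'.le h3'.le)]
  have hdist : ∀ n, dist (((M n).val 0 0 : ℝ) / (M n).val 1 0)
      (((M (n + 1)).val 0 0 : ℝ) / (M (n + 1)).val 1 0) ≤ 1 * (1 / 2) ^ n := by
    intro n
    have h1 : (0 : ℝ) < (M n).val 1 0 := by exact_mod_cast (hpos n).2.2.1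
    have h2 : (0 : ℝ) < (M (n + 1)).val 1 0 := by exact_mod_cast (hpos (n + 1)).2.2.1
    rw [Real.dist_eq, div_sub_div _ _ h1.ne' h2.ne', abs_div, abs_of_pos (mul_pos h1 h2)]
    have hd : |((M n).val 0 0 : ℝ) * (M (n + 1)).val 1 0 - (M n).val 1 0 * (M (n + 1)).val 0 0|
        = 1 := by
      have := det_entries (M (n + 1))
      rw [(hcol n 0).2, (hcol n 1).2] at this
      rw [abs_eq zero_le_one]
      rcases this with h | h
      · right
        have h' : (((M (n + 1)).val 0 0 : ℤ) : ℝ) * (M n).val 1 0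
          - (M n).val 0 0 * (M (n + 1)).val 1 0 = 1 := by exact_mod_cast h
        linarith
      · left
        have h' : (((M (n + 1)).val 0 0 : ℤ) : ℝ) * (M n).val 1 0
          - (M n).val 0 0 * (M (n + 1)).val 1 0 = -1 := by exact_mod_cast h
        linarith
    rw [hd, one_mul, one_div_pow]
    apply one_div_le_one_div_of_le (by positivity)
    exact_mod_cast hgrow n
  obtain ⟨γ, hγ⟩ := cauchySeq_tendsto_of_complete
    (cauchySeq_of_le_geometric _ _ (by norm_num) hdist)
  refine ⟨γ, ge_of_tendsto' hγ fun n => ?_, Eventually.of_forall fun n => (hpos n).2.2.1.ne', hγ⟩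
  exact div_nonneg (by exact_mod_cast (hpos n).1) (by exact_mod_cast (hpos n).2.2.1.le)

/-! ### Fixed points and quadratic irrationals -/

/-- Pass to the limit in `f (n + 1) ∞ = C (f n ∞)`. The equation is cleared of denominators because
`α` is not assumed irrational. -/
lemma ImageInftyTendsto.fixed {f : ℕ → GL2Z} {α : ℝ} (h : ImageInftyTendsto f α) (C : GL2Z)
    (hC : ∀ n, f (n + 1) = C * f n) :
    α * (C.val 1 0 * α + C.val 1 1) = C.val 0 0 * α + C.val 0 1 := by
  have hsucc := h.2.comp (tendsto_add_atTop_nat 1)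
  have hl := hsucc.mul ((h.2.const_mul (C.val 1 0 : ℝ)).add_const (C.val 1 1 : ℝ))
  have hr := (h.2.const_mul (C.val 0 0 : ℝ)).add_const (C.val 0 1 : ℝ)
  refine tendsto_nhds_unique (hl.congr' ?_) hr
  filter_upwards [h.1, (tendsto_add_atTop_nat 1).eventually h.1] with n h1 h2
  have h1' : ((f n).val 1 0 : ℝ) ≠ 0 := by exact_mod_cast h1
  have h2' : ((f (n + 1)).val 1 0 : ℝ) ≠ 0 := by exact_mod_cast h2
  have e0 : ((f (n + 1)).val 0 0 : ℝ) = C.val 0 0 * (f n).val 0 0 + C.val 0 1 * (f n).val 1 0 := by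
    rw [hC, mul_entry]; push_cast; ring
  have e1 : ((f (n + 1)).val 1 0 : ℝ) = C.val 1 0 * (f n).val 0 0 + C.val 1 1 * (f n).val 1 0 := by
    rw [hC, mul_entry]; push_cast; ring
  simp only [Function.comp_apply]
  rw [mul_div_assoc', mul_div_assoc', div_add' _ _ _ h1', div_add' _ _ _ h1', ← e0, ← e1]
  field_simp

lemma equivSimple_of_simple {β : ℕ} {a : ℕ → ℤ} {γ : ℝ} (ha : IsSimpleInterlacedCF β a)
    (h : ImageInftyTendsto (fun n =>
      signedInv 1 * prodTo (fun j => trans (a j) * signedInv 1) n) γ) : EquivSimple γ := by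
  refine ⟨1, 0, 0, 1, by simp, by simp, β, a, ha, ?_⟩
  have h2 := (cfConvergesTo_intCF_iff 0 (fun _ => 1) a γ).2 (by simpa [trans_zero] using h)
  simpa using h2

/-- The continued fraction `[0; m, 1, m, 1, …]` has the value `1 / (μ - 1)`, where
`μ = (m + 2) - 1 / μ`. -/
lemma equivSimple_of_add_inv {μ : ℝ} (hμ : 1 < μ) {m : ℤ} (hm : 0 < m)
    (h : μ ^ 2 = (m + 2) * μ - 1) : EquivSimple (1 / (μ - 1)) := by
  set a : ℕ → ℤ := fun j => if j % 2 = 0 then m else 1 with ha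
  have hpos : ∀ j, 0 < a j := fun j => by
    simp only [ha]; split_ifs <;> omega
  have hint : IsSimpleInterlacedCF 2 a := by
    refine ⟨by norm_num, hpos, fun i => if i.val = 0 then C m else 1, fun n i => ?_⟩
    fin_cases i <;> simp [ha, Nat.add_mod]
  obtain ⟨γ, hγ0, hγ⟩ := exists_limit_of_pos hpos
  have hsub := hγ.comp (φ := fun n => 2 * n)
    (tendsto_id.const_mul_atTop' (by norm_num : 0 < 2))
  -- The last `signedInv 1` cancels the leading one of the remaining product.
  have hfix := hsub.fixed (signedInv 1 * (trans m * signedInv 1) * (trans 1 * signedInv 1)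
      * signedInv 1) (fun n => by
    have hS : signedInv 1 * signedInv 1 = 1 := by
      apply gl_ext <;> simp [mul_entry]
    rw [show 2 * (n + 1) = 2 * n + 1 + 1 by ring, prodTo_succ', prodTo_succ']
    have e0 : a 0 = m := by simp [ha]
    have e1 : a (0 + 1) = 1 := by simp [ha]
    have e2 : ∀ k, a (k + 1 + 1) = a k := fun k => by simp [ha, add_assoc]
    simp only [e0, e1, e2]
    simp only [mul_assoc]
    rw [← mul_assoc (signedInv 1) (signedInv 1) (prodTo _ _), hS, one_mul])
  simp [mul_entry] at hfix
  have hm' : (0 : ℝ) < m := by exact_mod_cast hm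
  have hγ' : γ = 1 / (μ - 1) := by
    have hδ : (0 : ℝ) < 1 / (μ - 1) := by
      apply one_div_pos.2; linarith
    have hδ' : m * (1 / (μ - 1)) ^ 2 + m * (1 / (μ - 1)) - 1 = 0 := by
      have : μ - 1 ≠ 0 := by linarith
      field_simp
      linarith
    set δ := 1 / (μ - 1)
    -- Both numbers are roots of `m x² + m x - 1`, and nonnegativity of `γ` excludes a second root.
    have h0 : (γ - δ) * (m * (γ + δ + 1)) = 0 := by nlinarith
    rcases mul_eq_zero.1 h0 with h0 | h0
    · linarith
    · exact absurd h0 (by positivity)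
  rw [← hγ']
  exact equivSimple_of_simple hint hγ

/-- The number `l = c α + d` is an eigenvalue of `C`, and `μ = l ^ 2` is one of `C ^ 2`, which has
determinant `1` and trace `s`. Thus `μ + 1 / μ = s`, and either `μ` or its conjugate `s - μ` exceeds
`1`; both are affine in `α`. -/
lemma equivSimple_of_pow {C : GL2Z} {α : ℝ} (hα : Irrational α)
    (h : ImageInftyTendsto (fun n => C ^ n) α) : EquivSimple α := by
  have hfix := h.fixed C fun n => pow_succ' C n
  have hc : C.val 1 0 ≠ 0 := by
    intro hc
    obtain ⟨n, hn⟩ := h.1.exists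
    apply hn
    have : ∀ k, (C ^ k).val 1 0 = 0 := by
      intro k
      induction k with
      | zero => simp
      | succ k ih => rw [pow_succ, mul_entry, ih, hc]; ring
    exact this n
  set a := C.val 0 0
  set b := C.val 0 1
  set c := C.val 1 0
  set d := C.val 1 1
  obtain ⟨δ, hδ, hδ2⟩ : ∃ δ : ℤ, a * d - b * c = δ ∧ δ ^ 2 = 1 := by
    rcases det_entries C with h | h
    · exact ⟨1, h, by norm_num⟩
    · exact ⟨-1, h, by norm_num⟩
  have hδr : (a : ℝ) * d - b * c = δ := by exact_mod_cast hδ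
  have hδ2r : (δ : ℝ) ^ 2 = 1 := by exact_mod_cast hδ2
  have hl : Irrational (c * α + d) := by
    have := irrational_mobius_of_det (p := c) (q := d) (r := 0) (s := 1) hα (by simpa using hc)
    simpa using this
  set l := (c : ℝ) * α + d with hl_def
  have hchar : l ^ 2 = (a + d) * l - δ := by
    rw [← hδr]
    have : l * (l - d) = a * (l - d) + b * c := by
      have : l - d = c * α := by rw [hl_def]; ring
      rw [this]
      linear_combination (c : ℝ) * hfix
    linear_combination this
  -- With trace zero `l ^ 4 = 1`, impossible for a real irrational `l`.
  have ht : a + d ≠ 0 := by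
    intro ht
    have ht' : (a : ℝ) + d = 0 := by exact_mod_cast ht
    rw [ht', zero_mul, zero_sub] at hchar
    have h1 : (l - 1) * (l + 1) * (l ^ 2 + 1) = 0 := by
      have : l ^ 4 = 1 := by
        calc l ^ 4 = (l ^ 2) ^ 2 := by ring
          _ = 1 := by rw [hchar, neg_sq, hδ2r]
      linear_combination this
    rcases mul_eq_zero.1 h1 with h1 | h1
    · rcases mul_eq_zero.1 h1 with h1 | h1
      · exact hl ⟨1, by push_cast; linarith⟩
      · exact hl ⟨-1, by push_cast; linarith⟩
    · nlinarith
  set t := a + d with ht_def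
  set s := t ^ 2 - 2 * δ with hs_def
  have htr : ((t : ℤ) : ℝ) = a + d := by rw [ht_def]; push_cast; ring
  have hsr : (s : ℝ) = (a + d) ^ 2 - 2 * δ := by rw [hs_def]; push_cast; rw [htr]
  have hμ : (l ^ 2) ^ 2 = s * l ^ 2 - 1 := by
    rw [hsr]
    have : (l ^ 2 + δ) ^ 2 = (a + d) ^ 2 * l ^ 2 := by
      have h1 : l ^ 2 + δ = (a + d) * l := by linarith
      rw [h1]; ring
    linear_combination this - hδ2r
  have hlin : l ^ 2 = (t * c : ℤ) * α + (t * d - δ : ℤ) := by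
    rw [hchar]; push_cast; rw [htr, hl_def]; ring
  have hμirr : Irrational (l ^ 2) := by
    have := irrational_mobius_of_det (p := t * c) (q := t * d - δ) (r := 0) (s := 1) hα
      (by simpa using ⟨ht, hc⟩)
    rw [hlin]
    simpa using this
  set μ := l ^ 2 with hμ_def
  have hμ1 : μ ≠ 1 := fun h => hμirr ⟨1, by push_cast; exact h.symm⟩
  have hl0 : l ≠ 0 := fun h => hl ⟨0, by push_cast; exact h.symm⟩
  have hμ0 : 0 < μ := by positivity
  -- From `(μ - 1) ^ 2 = (s - 2) * μ` and `μ ≠ 1`.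
  have hs : 2 < s := by
    have h2 : (0 : ℝ) < (s - 2) * μ := by
      have : (0 : ℝ) < (μ - 1) ^ 2 := by
        have := sub_ne_zero.2 hμ1
        positivity
      linarith
    have h3 : (0 : ℝ) < s - 2 := pos_of_mul_pos_left h2 hμ0.le
    have h4 : ((2 : ℤ) : ℝ) < s := by push_cast; linarith
    exact_mod_cast h4
  have hsm : μ ^ 2 = (((s - 2 : ℤ) : ℝ) + 2) * μ - 1 := by push_cast; linarith
  rcases lt_or_gt_of_ne hμ1 with h1 | h1
  · have h2 : 1 < (s : ℝ) - μ := by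
      have : (2 : ℝ) < s := by exact_mod_cast hs
      linarith
    have h3 := equivSimple_of_add_inv (μ := s - μ) (m := s - 2) h2 (by linarith)
      (by push_cast; linarith)
    refine EquivSimple.of_homography hα (p := 0) (q := 1) (r := -(t * c))
      (s := s - (t * d - δ) - 1) ?_ ?_
    · simpa using ⟨ht, hc⟩
    · convert h3 using 2
      · simp
      · rw [hlin]; push_cast; ring
  · have h3 := equivSimple_of_add_inv (μ := μ) (m := s - 2) h1 (by linarith) hsm
    refine EquivSimple.of_homography hα (p := 0) (q := 1) (r := t * c)
      (s := t * d - δ - 1) ?_ ?_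
    · simpa using ⟨ht, hc⟩
    · convert h3 using 2
      · simp
      · rw [hlin]; push_cast; ring

/-! ### Periodic products: rotation and merging -/

/-- The ordered product of a list of sequences of transformations. -/
def block (F : List (ℕ → GL2Z)) (n : ℕ) : GL2Z := (F.map fun f => f n).prod

@[simp] lemma block_nil (n : ℕ) : block [] n = 1 := rfl
@[simp] lemma block_cons (f : ℕ → GL2Z) (F : List (ℕ → GL2Z)) (n : ℕ) :
    block (f :: F) n = f n * block F n := by simp [block]
@[simp] lemma block_append (F G : List (ℕ → GL2Z)) (n : ℕ) :
    block (F ++ G) n = block F n * block G n := by simp [block]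

/-- The product of interlaced transformations, taken one at a time or block by block. -/
lemma prodTo_interlaced (F : List (ℕ → GL2Z)) (f : ℕ → GL2Z)
    (hf : ∀ n i, (h : i < F.length) → f (n * F.length + i) = F[i] n) (N i : ℕ)
    (hi : i ≤ F.length) :
    prodTo f (N * F.length + i) = prodTo (block F) N * block (F.take i) N := by
  have hpart : ∀ N i, i ≤ F.length →
      prodTo (fun k => f (N * F.length + k)) i = block (F.take i) N := by
    intro N i
    induction i with
    | zero => intro _; simp [prodTo]
    | succ i ih =>
      intro hi
      rw [prodTo, ih (by omega), hf N i hi, List.take_succ_eq_append_getElem hi,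
        block_append, block_cons, block_nil, mul_one]
  have hN : ∀ N, prodTo f (N * F.length) = prodTo (block F) N := by
    intro N
    induction N with
    | zero => simp [prodTo]
    | succ N ih =>
      rw [add_mul, one_mul, prodTo_add, ih, hpart N _ le_rfl, List.take_length, prodTo]
  rw [prodTo_add, hN, hpart N i hi]

/-- All partial products of the periodically repeated list `F` send `∞` to points which tend
to `α`. -/
def PartialProductsTendTo (F : List (ℕ → GL2Z)) (α : ℝ) : Prop :=
  ∀ F' : List (ℕ → GL2Z), F' <+: F →
    ImageInftyTendsto (fun N => prodTo (block F) N * block F' N) α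

/-- The sequence without its first term. -/
def shift (f : ℕ → GL2Z) (n : ℕ) : GL2Z := f (n + 1)

/-- Regroup `x 0 · F 0 · x 1 · F 1 ⋯` after its first factor: the `x` closing block `n` is the one
that opened block `n + 1`, hence the shift. -/
lemma prodTo_block_rotate (x : ℕ → GL2Z) (F : List (ℕ → GL2Z)) (N : ℕ) :
    prodTo (block (F ++ [shift x])) N = (x 0)⁻¹ * (prodTo (block (x :: F)) N * x N) := by
  induction N with
  | zero => simp [prodTo]
  | succ N ih => simp [prodTo, ih, shift, mul_assoc]

/-- Prefixes of the rotated list correspond to longer prefixes of the old one, which is why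
convergence is demanded along all prefixes. -/
lemma PartialProductsTendTo.rotate_one {x : ℕ → GL2Z} {F : List (ℕ → GL2Z)} {α : ℝ}
    (hα : Irrational α) (h : PartialProductsTendTo (x :: F) α) :
    PartialProductsTendTo (F ++ [shift x]) (mobius (x 0)⁻¹ α) := by
  intro F' hF'
  rcases List.prefix_concat_iff.1 hF' with rfl | hF'
  -- The full rotated block ends with `x` of the next block, so the prefix `[x]` is used at index `N
  -- + 1`.
  · have h1 := ((h [x] (by simp)).comp (tendsto_add_atTop_nat 1)).mul_left hα (x 0)⁻¹
    refine h1.congr fun n => ?_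
    have : prodTo (block (F ++ [shift x])) n * block (F ++ [shift x]) n =
        prodTo (block (F ++ [shift x])) (n + 1) := rfl
    rw [this, prodTo_block_rotate]
    simp
  · have h1 := (h (x :: F') (by simpa using hF')).mul_left hα (x 0)⁻¹
    refine h1.congr fun n => ?_
    rw [prodTo_block_rotate]
    simp [mul_assoc]

lemma PartialProductsTendTo.rotate {F₁ F₂ : List (ℕ → GL2Z)} {α : ℝ}
    (hα : Irrational α) (h : PartialProductsTendTo (F₁ ++ F₂) α) :
    ∃ α', Irrational α' ∧ (EquivSimple α' → EquivSimple α) ∧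
      PartialProductsTendTo (F₂ ++ F₁.map shift) α' := by
  induction F₁ generalizing F₂ α with
  | nil => exact ⟨α, hα, id, by simpa using h⟩
  | cons x F₁ ih =>
    have h1 : PartialProductsTendTo (F₁ ++ (F₂ ++ [shift x])) (mobius (x 0)⁻¹ α) := by
      rw [← List.append_assoc]
      exact PartialProductsTendTo.rotate_one hα h
    obtain ⟨α', hα', h2, h3⟩ := ih (irrational_mobius _ hα) h1
    exact ⟨α', hα', fun h => EquivSimple.of_mobius hα _ (h2 h), by simpa using h3⟩

lemma PartialProductsTendTo.merge {x y : ℕ → GL2Z} {F : List (ℕ → GL2Z)} {α : ℝ}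
    (h : PartialProductsTendTo (x :: y :: F) α) :
    PartialProductsTendTo ((fun n => x n * y n) :: F) α := by
  have hb : block ((fun n => x n * y n) :: F) = block (x :: y :: F) := by
    ext1 n; simp [mul_assoc]
  intro F' hF'
  rw [hb]
  rcases List.prefix_cons_iff.1 hF' with rfl | ⟨t, rfl, ht⟩
  · exact h [] (by simp)
  · refine (h (x :: y :: t) (by simpa using ht)).congr fun n => ?_
    simp [mul_assoc]

/-! ### Letters, and conjugation by maps fixing infinity -/

/-- The sequence of transformations `x ↦ P n + G x`. -/
def letter (P : ℤ[X]) (G : GL2Z) (n : ℕ) : GL2Z := trans (P.eval (n : ℤ)) * G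

lemma letter_shift (P : ℤ[X]) (G : GL2Z) : shift (letter P G) = letter (P.comp (X + 1)) G := by
  ext1 n
  simp [shift, letter]

lemma lower_zero_diag {G : GL2Z} (h : G.val 1 0 = 0) :
    (G.val 0 0 = 1 ∨ G.val 0 0 = -1) ∧ (G.val 1 1 = 1 ∨ G.val 1 1 = -1) := by
  have h1 : IsUnit (G.val 0 0 * G.val 1 1) := by
    have := det_entries G
    rw [h, mul_zero, sub_zero] at this
    exact Int.isUnit_iff.2 this
  exact ⟨Int.isUnit_iff.1 (isUnit_of_mul_isUnit_left h1),
    Int.isUnit_iff.1 (isUnit_of_mul_isUnit_right h1)⟩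

/-- Such a `G` is affine with slope `±1`, so a translation passes through it up to sign. -/
lemma mul_trans_of_lower_zero {G : GL2Z} (h : G.val 1 0 = 0) (z : ℤ) :
    G * trans z = trans (G.val 0 0 * G.val 1 1 * z) * G := by
  obtain ⟨-, h2⟩ := lower_zero_diag h
  have h3 : G.val 1 1 * G.val 1 1 = 1 := by rcases h2 with h2 | h2 <;> rw [h2] <;> norm_num
  apply gl_ext
  · simp [mul_entry, h]
  · simp [mul_entry]
    linear_combination (-(G.val 0 0 * z)) * h3
  · simp [mul_entry, h]
  · simp [mul_entry, h]

lemma tendsto_eval_atTop_of_pos {P : ℤ[X]} (hd : 0 < P.natDegree) (hl : 0 < P.leadingCoeff) :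
    Tendsto (fun n : ℕ => P.eval (n : ℤ)) atTop atTop := by
  have h1 : Tendsto (fun x : ℝ => (P.map (Int.castRingHom ℝ)).eval x) atTop atTop := by
    apply Polynomial.tendsto_atTop_of_leadingCoeff_nonneg
    · rw [degree_map_eq_of_injective (by exact Int.cast_injective)]
      exact natDegree_pos_iff_degree_pos.1 hd
    · rw [leadingCoeff_map_of_injective (by exact Int.cast_injective)]
      simpa using hl.le
  have h2 := h1.comp tendsto_natCast_atTop_atTop
  rw [← tendsto_intCast_atTop_iff (R := ℝ)]
  refine h2.congr fun n => ?_
  simp only [Function.comp_apply]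
  simp

lemma eval_trichotomy (P : ℤ[X]) :
    (∃ c, P = C c) ∨ Tendsto (fun n : ℕ => P.eval (n : ℤ)) atTop atTop ∨
      Tendsto (fun n : ℕ => (-P).eval (n : ℤ)) atTop atTop := by
  by_cases hd : P.natDegree = 0
  · exact Or.inl ⟨_, eq_C_of_natDegree_eq_zero hd⟩
  · right
    have hd' : 0 < P.natDegree := Nat.pos_of_ne_zero hd
    have hP : P.leadingCoeff ≠ 0 := fun h => by
      rw [leadingCoeff_eq_zero] at h; simp [h] at hd
    rcases lt_or_gt_of_ne hP with h | h
    · right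
      exact tendsto_eval_atTop_of_pos (by simpa using hd') (by simpa using h)
    · left
      exact tendsto_eval_atTop_of_pos hd' h

/-- The sequence of transformations `x ↦ P n + 1 / x`. -/
abbrev simpleLetter (P : ℤ[X]) : ℕ → GL2Z := letter P (signedInv 1)

lemma ImageInftyTendsto.mul_right {f : ℕ → GL2Z} {α : ℝ} (h : ImageInftyTendsto f α) {X : GL2Z}
    (hX : X.val 1 0 = 0) : ImageInftyTendsto (fun n => f n * X) α := by
  refine h.congr_neg (f := f) ?_ |>.congr (f := fun n => if X.val 0 0 = 1 then f n else -f n) ?_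
  · intro n; split_ifs <;> simp
  · intro n
    rcases (lower_zero_diag hX).1 with h | h <;> simp [mul_entry, hX, h]

lemma prodTo_mul_eq {f g : ℕ → GL2Z} {X : GL2Z}
    (h : ∀ n, f n * X = X * g n ∨ f n * X = -(X * g n)) (N : ℕ) :
    X * prodTo g N = prodTo f N * X ∨ X * prodTo g N = -(prodTo f N * X) := by
  induction N with
  | zero => simp [prodTo]
  | succ N ih =>
    rw [prodTo, prodTo, ← mul_assoc, mul_assoc (prodTo f N)]
    rcases ih with ih | ih <;> rcases h N with h | h <;> rw [ih, h] <;> simp [mul_assoc]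

/-- The relations telescope to `prodTo g = ± X⁻¹ * prodTo f * X`, and the final `X` fixes `∞`. -/
lemma ImageInftyTendsto.conj {f g : ℕ → GL2Z} {α : ℝ} (hα : Irrational α)
    (h : ImageInftyTendsto (prodTo f) α) {X : GL2Z} (hX : X.val 1 0 = 0)
    (hfg : ∀ n, f n * X = X * g n ∨ f n * X = -(X * g n)) :
    ImageInftyTendsto (prodTo g) (mobius X⁻¹ α) := by
  have h1 := ((h.mul_right hX).congr_neg (prodTo_mul_eq hfg)).mul_left hα X⁻¹
  simpa using h1

lemma ImageInftyTendsto.drop {f : ℕ → GL2Z} {α : ℝ} (hα : Irrational α)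
    (h : ImageInftyTendsto (prodTo f) α) (N : ℕ) :
    ImageInftyTendsto (prodTo fun n => f (N + n)) (mobius (prodTo f N)⁻¹ α) := by
  have h1 := (h.comp (tendsto_add_atTop_nat N)).mul_left hα (prodTo f N)⁻¹
  refine h1.congr fun n => ?_
  rw [add_comm n N, prodTo_add]
  simp

/-! ### Euclidean decomposition -/

/-- A transformation which does not fix `∞` is, up to sign, a positive continued fraction between
two translations. -/
lemma exists_decomposition_of_pos (k : ℕ) : ∀ G : GL2Z, G.val 1 0 = (k : ℤ) → 0 < k →
    ∃ (x y : ℤ) (e : List ℤ), (∀ z ∈ e, 0 < z) ∧ ((k : ℤ) < G.val 0 0 → 0 < x) ∧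
      G = trans x * signedInv 1 * (e.map fun z => trans z * signedInv 1).prod * trans y := by
  induction k using Nat.strong_induction_on with
  | _ k ih =>
  intro G hk hpos
  rcases Nat.lt_or_ge 1 k with h1 | h1
  · set a := G.val 0 0 with ha
    have hk0 : (0 : ℤ) < k := by exact_mod_cast hpos
    have hr0 : 0 ≤ a % k := Int.emod_nonneg _ hk0.ne'
    have hrk : a % k < k := Int.emod_lt_of_pos _ hk0
    have hr : a % k ≠ 0 := by
      intro h0
      have hdvd : (k : ℤ) ∣ a := Int.dvd_of_emod_eq_zero h0
      have hu : IsUnit (k : ℤ) := by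
        have : (k : ℤ) ∣ a * G.val 1 1 - G.val 0 1 * G.val 1 0 :=
          dvd_sub (hdvd.mul_right _) (by rw [hk]; exact dvd_mul_left _ _)
        apply isUnit_of_dvd_unit this
        exact Int.isUnit_iff.2 (det_entries G)
      rw [Int.isUnit_iff] at hu
      omega
    -- One step of Euclid's algorithm on the first column `(a, k)`, which becomes `(k, a % k)`.
    set H := signedInv 1 * (trans (-(a / k)) * G) with hH
    have hG : G = trans (a / k) * signedInv 1 * H := by
      have hS : signedInv 1 * signedInv 1 = 1 := by
        apply gl_ext <;> simp [mul_entry]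
      rw [hH, mul_assoc, ← mul_assoc (signedInv 1) (signedInv 1), hS, one_mul, ← mul_assoc,
        ← trans_add]
      simp [trans_zero]
    have hH10 : H.val 1 0 = a % k := by
      simp only [hH, mul_entry, ← ha, hk]
      simp
      have := Int.emod_add_mul_ediv a k
      linarith
    have hH00 : H.val 0 0 = k := by
      simp only [hH, mul_entry, ← ha, hk]
      simp
    -- Since `a % k < k`, the positivity clause applies to `H`, so the new quotient `x` is positive.
    obtain ⟨x, y, e, he, hx, hdec⟩ := ih (a % k).toNat (by omega) H (by omega) (by omega)
    refine ⟨a / k, y, x :: e, ?_, ?_, ?_⟩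
    · intro z hz
      rcases List.mem_cons.1 hz with rfl | hz
      · exact hx (by omega)
      · exact he z hz
    · intro h
      have : 1 ≤ a / k := Int.le_ediv_of_mul_le hk0 (by linarith)
      omega
    · rw [hG, hdec]
      simp [mul_assoc]
  · obtain rfl : k = 1 := by omega
    have hdet := det_entries G
    rw [hk] at hdet
    rcases hdet with h | h
    -- A single inversion has determinant `-1`; determinant `1` needs an extra partial quotient `1`.
    · refine ⟨G.val 0 0 - 1, G.val 1 1 - 1, [1], by simp, by simp, ?_⟩
      apply gl_ext <;> simp [mul_entry] <;> push_cast at * <;> linarith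
    · refine ⟨G.val 0 0, G.val 1 1, [], by simp, by push_cast; omega, ?_⟩
      apply gl_ext <;> simp [mul_entry] <;> push_cast at * <;> linarith

lemma exists_decomposition {G : GL2Z} (hG : G.val 1 0 ≠ 0) :
    ∃ (x y : ℤ) (e : List ℤ), (∀ z ∈ e, 0 < z) ∧
      (G = trans x * signedInv 1 * (e.map fun z => trans z * signedInv 1).prod * trans y ∨
      G = -(trans x * signedInv 1 * (e.map fun z => trans z * signedInv 1).prod * trans y)) := by
  rcases lt_or_gt_of_ne hG with h | h
  · obtain ⟨x, y, e, he, -, hdec⟩ := exists_decomposition_of_pos (-G.val 1 0).toNat (-G)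
      (by simp; omega) (by omega)
    exact ⟨x, y, e, he, Or.inr (by rw [← hdec, neg_neg])⟩
  · obtain ⟨x, y, e, he, -, hdec⟩ := exists_decomposition_of_pos (G.val 1 0).toNat G
      (by omega) (by omega)
    exact ⟨x, y, e, he, Or.inl hdec⟩

/-! ### Normalising signs and translations -/

/-- The sequence is of the form `x ↦ P n + G x` with `P n → ∞` and `G ∞ ≠ ∞`. -/
def IsPositiveLetter (f : ℕ → GL2Z) : Prop :=
  ∃ (P : ℤ[X]) (G : GL2Z), f = letter P G ∧ G.val 1 0 ≠ 0 ∧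
    Tendsto (fun n : ℕ => P.eval (n : ℤ)) atTop atTop

/-- The sequence is of the form `x ↦ P n + G x` with `|P n| → ∞` and `G ∞ ≠ ∞`. -/
def IsProperLetter (f : ℕ → GL2Z) : Prop :=
  ∃ (P : ℤ[X]) (G : GL2Z), f = letter P G ∧ G.val 1 0 ≠ 0 ∧
    (Tendsto (fun n : ℕ => P.eval (n : ℤ)) atTop atTop ∨
      Tendsto (fun n : ℕ => (-P).eval (n : ℤ)) atTop atTop)

/-- A sign change is `1` or `x ↦ -x`. -/
def IsSignChange (J : GL2Z) : Prop := J = 1 ∨ J = negation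

lemma IsSignChange.lower_zero {J : GL2Z} (h : IsSignChange J) : J.val 1 0 = 0 := by
  rcases h with rfl | rfl <;> simp

/-- `J` depends only on the sign of `P` at infinity, while the incoming `J'` is absorbed into `G`.
Signs can therefore be pushed leftwards through a block. -/
lemma IsProperLetter.exists_positive {f : ℕ → GL2Z} (h : IsProperLetter f) :
    ∃ J, IsSignChange J ∧ ∀ J', IsSignChange J' → ∃ f', IsPositiveLetter f' ∧
      ∀ n, f n * J' = J * f' n := by
  obtain ⟨P, G, rfl, hG, hP | hP⟩ := h
  · refine ⟨1, Or.inl rfl, fun J' hJ' => ⟨letter P (G * J'), ⟨P, G * J', rfl, ?_, hP⟩, ?_⟩⟩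
    · rcases hJ' with rfl | rfl <;> simpa [mul_entry] using hG
    · intro n; simp [letter, mul_assoc]
  · refine ⟨negation, Or.inr rfl, fun J' hJ' =>
      ⟨letter (-P) (negation * G * J'), ⟨-P, negation * G * J', rfl, ?_, hP⟩, ?_⟩⟩
    · rcases hJ' with rfl | rfl <;> simpa [mul_entry] using hG
    · intro n
      rw [letter, letter, eval_neg, ← mul_assoc negation, negation_mul_trans, neg_neg,
        mul_assoc (trans _) negation, ← mul_assoc negation (negation * G), ← mul_assoc negation,
        negation_mul_self, one_mul, mul_assoc]

lemma exists_positive_block {F : List (ℕ → GL2Z)} (hF : F ≠ [])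
    (h : ∀ f ∈ F, IsProperLetter f) :
    ∃ J, IsSignChange J ∧ ∀ J', IsSignChange J' → ∃ F' : List (ℕ → GL2Z), F' ≠ [] ∧
      (∀ f ∈ F', IsPositiveLetter f) ∧ ∀ n, block F n * J' = J * block F' n := by
  induction F with
  | nil => exact absurd rfl hF
  | cons x F ih =>
    obtain ⟨J, hJ, hx⟩ := (h x (by simp)).exists_positive
    refine ⟨J, hJ, fun J' hJ' => ?_⟩
    by_cases hF0 : F = []
    · subst hF0
      obtain ⟨f', hf', h1⟩ := hx J' hJ'
      exact ⟨[f'], by simp, by simpa using hf', fun n => by simp [h1]⟩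
    · obtain ⟨J₂, hJ₂, h2⟩ := ih hF0 fun f hf => h f (by simp [hf])
      obtain ⟨F', -, hF'2, hF'3⟩ := h2 J' hJ'
      obtain ⟨f', hf', h1⟩ := hx J₂ hJ₂
      refine ⟨f' :: F', by simp, ?_, fun n => ?_⟩
      · intro f hf
        rcases List.mem_cons.1 hf with rfl | hf
        · exact hf'
        · exact hF'2 f hf
      · rw [block_cons, block_cons, mul_assoc, hF'3, ← mul_assoc, h1, mul_assoc]

/-- The polynomial takes positive values at all large integers. -/
def EventuallyPos (P : ℤ[X]) : Prop := ∀ᶠ n : ℕ in atTop, 0 < P.eval (n : ℤ)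

/-- The incoming `v` only alters the polynomial, which still tends to `+∞`. The outgoing `w` comes
from `G` alone, so in a whole block `v = w` may be chosen. -/
lemma IsPositiveLetter.exists_simple {f : ℕ → GL2Z} (h : IsPositiveLetter f) :
    ∃ w : ℤ, ∀ v : ℤ, ∃ l : List ℤ[X], l ≠ [] ∧ (∀ P ∈ l, EventuallyPos P) ∧
      ((∀ n, trans v * f n = block (l.map simpleLetter) n * trans w) ∨
        ∀ n, trans v * f n = -(block (l.map simpleLetter) n * trans w)) := by
  obtain ⟨P, G, rfl, hG, hP⟩ := h
  obtain ⟨x, y, e, he, hdec⟩ := exists_decomposition hG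
  refine ⟨y, fun v => ⟨(C v + P + C x) :: e.map C, by simp, ?_, ?_⟩⟩
  · intro Q hQ
    rcases List.mem_cons.1 hQ with rfl | hQ
    · filter_upwards [hP.eventually_gt_atTop (-v - x)] with n hn
      simp
      linarith
    · obtain ⟨z, hz, rfl⟩ := List.mem_map.1 hQ
      exact Eventually.of_forall fun n => by simpa using he z hz
  · have hb : ∀ n, block (((C v + P + C x) :: e.map C).map simpleLetter) n =
        trans v * trans (P.eval (n : ℤ)) *
          (trans x * signedInv 1 * (e.map fun z => trans z * signedInv 1).prod) := by
      intro n
      have : block ((e.map C).map simpleLetter) n =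
          (e.map fun z => trans z * signedInv 1).prod := by
        simp [block, letter, Function.comp_def]
      rw [List.map_cons, block_cons, this]
      simp [letter, trans_add, mul_assoc]
    rcases hdec with hdec | hdec
    · left
      intro n
      rw [hb, letter, hdec]
      simp only [mul_assoc]
    · right
      intro n
      rw [hb, letter, hdec]
      simp only [mul_assoc, mul_neg]

lemma exists_simple_block {F : List (ℕ → GL2Z)} (hF : F ≠ [])
    (h : ∀ f ∈ F, IsPositiveLetter f) :
    ∃ w : ℤ, ∀ v : ℤ, ∃ l : List ℤ[X], l ≠ [] ∧ (∀ P ∈ l, EventuallyPos P) ∧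
      ((∀ n, trans v * block F n = block (l.map simpleLetter) n * trans w) ∨
        ∀ n, trans v * block F n = -(block (l.map simpleLetter) n * trans w)) := by
  induction F with
  | nil => exact absurd rfl hF
  | cons x F ih =>
    obtain ⟨u, hu⟩ := (h x (by simp)).exists_simple
    by_cases hF0 : F = []
    · subst hF0
      simpa using ⟨u, hu⟩
    · obtain ⟨w, hw⟩ := ih hF0 fun f hf => h f (by simp [hf])
      refine ⟨w, fun v => ?_⟩
      obtain ⟨l₁, hl₁, hp₁, h₁⟩ := hu v
      obtain ⟨l₂, hl₂, hp₂, h₂⟩ := hw u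
      refine ⟨l₁ ++ l₂, by simp [hl₁], ?_, ?_⟩
      · intro P hP
        rcases List.mem_append.1 hP with hP | hP
        · exact hp₁ P hP
        · exact hp₂ P hP
      · simp only [block_cons, List.map_append, block_append]
        rcases h₁ with h₁ | h₁ <;> rcases h₂ with h₂ | h₂
        · left; intro n; rw [← mul_assoc, h₁, mul_assoc, h₂, mul_assoc]
        · right; intro n; rw [← mul_assoc, h₁, mul_assoc, h₂, mul_neg, mul_assoc]
        · right; intro n; rw [← mul_assoc, h₁, neg_mul, mul_assoc, h₂, mul_assoc]
        · left
          intro n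
          rw [← mul_assoc, h₁, neg_mul, mul_assoc, h₂, mul_neg, neg_neg, mul_assoc]

lemma equivSimple_of_list {l : List ℤ[X]} (hl : l ≠ [])
    (hpos : ∀ P ∈ l, ∀ n : ℕ, 0 < P.eval (n : ℤ)) {α : ℝ} (hα : Irrational α)
    (h : ImageInftyTendsto (prodTo (block (l.map simpleLetter))) α) : EquivSimple α := by
  have hm : 0 < l.length := List.length_pos_iff.2 hl
  set a : ℕ → ℤ := fun j =>
    (l[j % l.length]'(Nat.mod_lt _ hm)).eval ((j / l.length : ℕ) : ℤ) with ha
  have hval : ∀ n i, (hi : i < l.length) → a (n * l.length + i) = (l[i]).eval (n : ℤ) := by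
    intro n i hi
    have h1 : (n * l.length + i) % l.length = i := by
      rw [Nat.mul_add_mod_self_right, Nat.mod_eq_of_lt hi]
    have h2 : (n * l.length + i) / l.length = n := by
      rw [mul_comm, Nat.mul_add_div hm, Nat.div_eq_of_lt hi, add_zero]
    simp only [ha, h1, h2]
  have hapos : ∀ j, 0 < a j := fun j => hpos _ (List.getElem_mem _) _
  have hsimple : IsSimpleInterlacedCF l.length a := by
    -- Interlacing evaluates at `n + 1`, letters at `n`.
    refine ⟨hm, hapos, fun i => (l[i]).comp (X - 1), fun n i => ?_⟩
    rw [hval n i i.2]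
    simp
  obtain ⟨γ, -, hγ⟩ := exists_limit_of_pos hapos
  have hflat : ∀ N, prodTo (fun j => trans (a j) * signedInv 1) (N * l.length) =
      prodTo (block (l.map simpleLetter)) N := by
    intro N
    have := prodTo_interlaced (l.map simpleLetter) (fun j => trans (a j) * signedInv 1)
      (fun n i hi => by
        have hi' : i < l.length := by simpa using hi
        rw [List.length_map, hval n i hi', List.getElem_map]
        rfl) N 0 (Nat.zero_le _)
    simpa using this
  have hsub := hγ.comp (φ := fun N => N * l.length) (tendsto_id.atTop_mul_const' hm)
  simp only [hflat] at hsub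
  have huniq : γ = mobius (signedInv 1) α := tendsto_nhds_unique hsub.2 (h.mul_left hα _).2
  exact EquivSimple.of_mobius hα (signedInv 1) (huniq ▸ equivSimple_of_simple hsimple hγ)

lemma equivSimple_of_proper {F : List (ℕ → GL2Z)} (hF : F ≠ [])
    (hp : ∀ f ∈ F, IsProperLetter f) {α : ℝ} (hα : Irrational α)
    (h : ImageInftyTendsto (prodTo (block F)) α) : EquivSimple α := by
  obtain ⟨J, hJ, h1⟩ := exists_positive_block hF hp
  -- Taking `J' = J` turns the relation into a conjugation.
  obtain ⟨F', hF', hpos, hFF'⟩ := h1 J hJ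
  have h2 := h.conj hα hJ.lower_zero fun n => Or.inl (hFF' n)
  refine EquivSimple.of_mobius hα J⁻¹ ?_
  have hα₂ := irrational_mobius J⁻¹ hα
  generalize mobius J⁻¹ α = α₂ at h2 hα₂ ⊢
  obtain ⟨w, hw⟩ := exists_simple_block hF' hpos
  obtain ⟨l, hl, hlpos, hFl⟩ := hw w
  have hinv : trans w * trans (-w) = 1 := by rw [← trans_add, add_neg_cancel, trans_zero]
  have hinv' : trans (-w) * trans w = 1 := by rw [← trans_add, neg_add_cancel, trans_zero]
  have h3 := h2.conj (g := block (l.map simpleLetter)) hα₂ (X := trans (-w)) (by simp) fun n => by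
    have e : block F' n = trans (-w) * (trans w * block F' n) := by
      rw [← mul_assoc, hinv', one_mul]
    rw [e]
    rcases hFl with hFl | hFl
    · left; rw [hFl, mul_assoc, mul_assoc, hinv, mul_one]
    · right; rw [hFl, mul_assoc, neg_mul, mul_assoc, hinv, mul_one, mul_neg]
  refine EquivSimple.of_mobius hα₂ (trans (-w))⁻¹ ?_
  have hα₃ := irrational_mobius (trans (-w))⁻¹ hα₂
  generalize mobius (trans (-w))⁻¹ α₂ = α₃ at h3 hα₃ ⊢
  -- Finitely many polynomials are positive simultaneously from some index on.
  have hev : ∀ᶠ n : ℕ in atTop, ∀ P ∈ l.toFinset, 0 < P.eval (n : ℤ) := by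
    rw [Filter.eventually_all_finset]
    intro P hP
    exact hlpos P (List.mem_toFinset.1 hP)
  obtain ⟨N, hN⟩ := eventually_atTop.1 hev
  have h4 := h3.drop hα₃ N
  refine EquivSimple.of_mobius hα₃ _ (equivSimple_of_list
    (l := l.map fun P => P.comp (X + C (N : ℤ))) (by simpa using hl) ?_
    (irrational_mobius _ hα₃) (α := mobius (prodTo (block (l.map simpleLetter)) N)⁻¹ α₃) ?_)
  · intro P hP n
    obtain ⟨Q, hQ, rfl⟩ := List.mem_map.1 hP
    have := hN (n + N) (by omega) Q (List.mem_toFinset.2 hQ)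
    simpa using this
  · convert h4 using 2
    ext1 n
    simp [block, letter, Function.comp_def, add_comm]

/-! ### Reduction of the period -/

/-- The sequence is of the form `x ↦ P n + G x`. -/
def IsLetter (f : ℕ → GL2Z) : Prop := ∃ (P : ℤ[X]) (G : GL2Z), f = letter P G

lemma IsLetter.shift {f : ℕ → GL2Z} (h : IsLetter f) : IsLetter (shift f) := by
  obtain ⟨P, G, rfl⟩ := h
  exact ⟨_, _, letter_shift P G⟩

lemma shift_letter_C (c : ℤ) (G : GL2Z) : shift (letter (C c) G) = letter (C c) G := by
  simp [letter_shift]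

/-- A letter in a list of at least two letters can be rotated to the second position. -/
lemma exists_rotation_second {F : List (ℕ → GL2Z)} {y : ℕ → GL2Z} (hy : y ∈ F)
    (hlen : 2 ≤ F.length) (hF : ∀ f ∈ F, IsLetter f) {α : ℝ} (hα : Irrational α)
    (h : PartialProductsTendTo F α) :
    ∃ x y' F' α', (y' = y ∨ y' = shift y) ∧ (x :: y' :: F').length = F.length ∧
      (∀ f ∈ x :: y' :: F', IsLetter f) ∧ Irrational α' ∧ (EquivSimple α' → EquivSimple α) ∧
      PartialProductsTendTo (x :: y' :: F') α' := by
  obtain ⟨L, R, rfl⟩ := List.append_of_mem hy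
  rcases List.eq_nil_or_concat L with rfl | ⟨L, w, rfl⟩
  · rcases List.eq_nil_or_concat R with rfl | ⟨R, w, rfl⟩
    · simp at hlen
    · have h' : PartialProductsTendTo ((y :: R) ++ [w]) α := by simpa using h
      obtain ⟨α', hα', hE, hT⟩ := h'.rotate hα
      refine ⟨w, shift y, R.map shift, α', Or.inr rfl, by simp, ?_, hα', hE, by simpa using hT⟩
      intro f hf
      simp only [List.mem_cons, List.mem_map] at hf
      rcases hf with rfl | rfl | ⟨g, hg, rfl⟩
      · exact hF _ (by simp)
      · exact (hF _ (by simp)).shift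
      · exact (hF _ (by simp [hg])).shift
  · have h' : PartialProductsTendTo (L ++ w :: y :: R) α := by simpa using h
    obtain ⟨α', hα', hE, hT⟩ := h'.rotate hα
    refine ⟨w, y, R ++ L.map shift, α', Or.inl rfl, by simp; omega, ?_, hα', hE, by simpa using hT⟩
    intro f hf
    simp only [List.mem_cons, List.mem_map, List.mem_append] at hf
    rcases hf with rfl | rfl | hf | ⟨g, hg, rfl⟩
    · exact hF _ (by simp)
    · exact hF _ (by simp)
    · exact hF _ (by simp [hf])
    · exact (hF _ (by simp [hg])).shift

theorem equivSimple_of_letters (k : ℕ) : ∀ F : List (ℕ → GL2Z), F.length = k → F ≠ [] →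
    (∀ f ∈ F, IsLetter f) → ∀ α, Irrational α → PartialProductsTendTo F α → EquivSimple α := by
  induction k using Nat.strong_induction_on with
  | _ k ih =>
  intro F hk hne hF α hα h
  have hnil : ImageInftyTendsto (prodTo (block F)) α := by
    simpa using h [] (by simp)
  have hmerge : ∀ (x y : ℕ → GL2Z) (F' : List (ℕ → GL2Z)) (α' : ℝ),
      (x :: y :: F').length = k → (∀ f ∈ x :: y :: F', IsLetter f) → Irrational α' →
      PartialProductsTendTo (x :: y :: F') α' → IsLetter (fun n => x n * y n) →
      EquivSimple α' := by
    intro x y F' α' hlen hF' hα' hT hxy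
    refine ih (k - 1) (by simp at hlen; omega) _ (by simp at hlen ⊢; omega) (by simp) ?_ α' hα'
      hT.merge
    intro f hf
    rcases List.mem_cons.1 hf with rfl | hf
    · exact hxy
    · exact hF' f (by simp [hf])
  have hone : F.length < 2 → ∃ f, F = [f] := fun hlt => by
    rw [← List.length_eq_one_iff]
    have := List.length_pos_iff.2 hne
    omega
  by_cases hconst : ∃ c G, letter (C c) G ∈ F
  · obtain ⟨c, G, hc⟩ := hconst
    rcases Nat.lt_or_ge F.length 2 with hlt | hlt
    · obtain ⟨f, rfl⟩ := hone hlt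
      obtain rfl := List.mem_singleton.1 hc
      have hpow : prodTo (block [letter (C c) G]) = fun n => (trans c * G) ^ n := by
        ext1 n
        rw [← prodTo_const]
        congr 1
        ext1 n
        simp [letter]
      rw [hpow] at hnil
      exact equivSimple_of_pow hα hnil
    · obtain ⟨x, y, F', α', hy, hlen, hF', hα', hE, hT⟩ := exists_rotation_second hc hlt hF hα h
      rw [shift_letter_C, or_self] at hy
      subst hy
      -- The constant map `trans c * G` is absorbed into the group element of the letter before it.
      refine hE (hmerge _ _ _ _ (hlen.trans hk) hF' hα' hT ?_)
      obtain ⟨P, H, rfl⟩ := hF' x (by simp)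
      exact ⟨P, H * (trans c * G), by ext1 n; simp [letter, mul_assoc]⟩
  by_cases hup : ∃ P G, letter P G ∈ F ∧ G.val 1 0 = 0
  · obtain ⟨P, G, hP, hG⟩ := hup
    rcases Nat.lt_or_ge F.length 2 with hlt | hlt
    · obtain ⟨f, rfl⟩ := hone hlt
      obtain rfl := List.mem_singleton.1 hP
      -- Every product would fix `∞`, contrary to convergence to a real number.
      exfalso
      obtain ⟨n, hn⟩ := hnil.1.exists
      apply hn
      induction n with
      | zero => simp [prodTo]
      | succ n ih =>
        rw [prodTo, mul_entry]
        by_cases h0 : (prodTo (block [letter P G]) n).val 1 0 = 0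
        · simp [h0, letter, mul_entry, hG]
        · exact absurd (ih h0) h0
    · obtain ⟨L, R, rfl⟩ := List.append_of_mem hP
      obtain ⟨α', hα', hE, hT⟩ := h.rotate hα
      have hF' : ∀ f ∈ letter P G :: R ++ L.map shift, IsLetter f := by
        intro f hf
        simp only [List.mem_append, List.mem_map] at hf
        rcases hf with hf | ⟨g, hg, rfl⟩
        · exact hF _ (List.mem_append_right _ hf)
        · exact (hF _ (by simp [hg])).shift
      have hlen : (letter P G :: R ++ L.map shift).length = k := by
        rw [← hk]; simp; omega
      refine hE ?_
      rw [List.cons_append] at hT hF' hlen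
      obtain ⟨y, F', hyF⟩ : ∃ y F', R ++ L.map shift = y :: F' := by
        apply List.exists_cons_of_ne_nil
        intro h0
        rw [h0] at hlen
        simp at hlen
        omega
      rw [hyF] at hT hF' hlen
      refine hmerge _ _ _ _ hlen hF' hα' hT ?_
      obtain ⟨Q, H, rfl⟩ := hF' y (by simp)
      refine ⟨P + C (G.val 0 0 * G.val 1 1) * Q, G * H, ?_⟩
      ext1 n
      simp only [letter]
      rw [mul_assoc (trans _) G, ← mul_assoc G, mul_trans_of_lower_zero hG, ← mul_assoc,
        ← mul_assoc, ← trans_add]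
      simp [mul_assoc]
  push Not at hconst hup
  refine equivSimple_of_proper hne (fun f hf => ?_) hα hnil
  obtain ⟨P, G, rfl⟩ := hF f hf
  refine ⟨P, G, rfl, hup P G hf, ?_⟩
  rcases eval_trichotomy P with ⟨c, rfl⟩ | hP
  · exact absurd hf (hconst c G)
  · exact hP

end InterlacedCF

theorem theorem2 (β : ℕ) (a₀ : ℤ) (b a : ℕ → ℤ) (α : ℝ)
    (hcf : IsSignedInterlacedCF β b a)
    (hconv : CFConvergesTo (intCF a₀ b a) α)
    (hirr : Irrational α) :
    ∃ p q r s : ℤ, p * s - q * r ≠ 0 ∧ (r : ℝ) * α + s ≠ 0 ∧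
      ∃ (β' : ℕ) (a' : ℕ → ℤ), IsSimpleInterlacedCF β' a' ∧
        CFConvergesTo (intCF 0 (fun _ => 1) a') (((p : ℝ) * α + q) / ((r : ℝ) * α + s)) := by
  open InterlacedCF in
  change EquivSimple α
  have hunit : ∀ j, ∃ u : ℤˣ, (u : ℤ) = b j := fun j => Int.isUnit_iff.2 (hcf.num_sign j)
  choose B hB using hunit
  obtain rfl : (fun j => (B j : ℤ)) = b := funext hB
  obtain ⟨A, hA⟩ := hcf.den_interlaced
  -- The letter of `a j` carries the next sign `B (j + 1)`; the initial `B 0` goes into `X₀`.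
  have hper : ∀ n i, B (n * β + i + 1) = B (i + 1) := by
    intro n i
    apply Units.ext
    have := hcf.num_periodic.nat_mul n (i + 1)
    simp only [Nat.cast_id] at this
    rw [← this]
    congr 2
    ring
  rw [cfConvergesTo_intCF_iff] at hconv
  set X₀ := trans a₀ * signedInv (B 0)
  set f := fun j => trans (a j) * signedInv (B (j + 1))
  set F : List (ℕ → GL2Z) := List.ofFn fun i : Fin β =>
    letter ((A i).comp (X + 1)) (signedInv (B (i + 1))) with hFdef
  have hlen : F.length = β := by simp [hFdef]
  have hflat : ∀ N i, i ≤ β →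
      prodTo f (N * β + i) = prodTo (block F) N * block (F.take i) N := by
    intro N i hi
    have := prodTo_interlaced F f (fun n i hi => by
      have hi' : i < β := by simpa [hlen] using hi
      have h1 := hA n ⟨i, hi'⟩
      have hget : F[i] = letter ((A ⟨i, hi'⟩).comp (X + 1)) (signedInv (B (i + 1))) :=
        List.getElem_ofFn _
      rw [hget, hlen]
      simp only at h1
      simp [f, h1, hper, letter]) N i (by rwa [hlen])
    rwa [hlen] at this
  have h1 : ImageInftyTendsto (prodTo f) (mobius X₀⁻¹ α) := by
    simpa using hconv.mul_left hirr X₀⁻¹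
  refine EquivSimple.of_mobius hirr X₀⁻¹ (equivSimple_of_letters _ F rfl ?_ ?_ _
    (irrational_mobius _ hirr) ?_)
  · intro h0
    have := hcf.period_pos
    rw [h0] at hlen
    simp at hlen
    omega
  · intro g hg
    obtain ⟨i, rfl⟩ := (List.mem_ofFn' _ _).1 hg
    exact ⟨_, _, rfl⟩
  -- Each prefix selects the convergents in one residue class modulo `β`, a subsequence of the given
  -- one.
  · intro F' hF'
    rw [List.prefix_iff_eq_take] at hF'
    have hle : F'.length ≤ β := by
      rw [hF', List.length_take, hlen]
      exact min_le_right _ _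
    have h2 := h1.comp (φ := fun N => N * β + F'.length)
      (tendsto_atTop_mono (fun N => Nat.le_add_right _ _)
        (tendsto_id.atTop_mul_const' hcf.period_pos))
    simp only [hflat _ _ hle, ← hF'] at h2
    exact h2
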